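/- Let $d\ge 0$ be an integer and equip $\mathbb{R}^d$ with the Euclidean norm. A lattice is a subgroup $\Lambda=\{\sum_{i=1}^d a_iv_i \mid a_i\in\mathbb{Z}\}$ of $\mathbb{R}^d$, where $v_1,\dots,v_d$ is a basis of $\mathbb{R}^d$; its unit cell with respect to these generators is $U(\Lambda)=\{\sum_{i=1}^d t_iv_i \mid t_i\in[0,1)\}$. A periodic point set of $\mathbb{R}^d$ is a set of the form $X=\Lambda+P=\{\lambda+x\mid\lambda\in\Lambda,\ x\in P\}$, where $\Lambda$ is a lattice and $P$ is a non-empty finite subset of $U(\Lambda)$. Its density is $\operatorname{den}(X)=|P|/\operatorname{Vol}(U(\Lambda))$, which does not depend on the choice of $v_1,\dots,v_d$ and $P$ representing $X$. Let $\mathrm{PPS}(\mathbb{R}^d)$ be the family of all periodic point sets of $\mathbb{R}^d$ and, for $\kappa\in\mathbb{R}$, let $\mathrm{PPS}(\mathbb{R}^d,\kappa)=\{X\in \mathrm{PPS}(\mathbb{R}^d)\mid \operatorname{den}(X)=\kappa\}$. For $X,Y\subseteq\mathbb{R}^d$ put $$d_B(X,Y)=\inf_{f\colon X\to Y\text{ bijection}}\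 \sup_{x\in X}\|x-f(x)\|,\qquad d_{EB}(X,Y)=\inf_{\psi\in\mathrm{Iso}(\mathbb{R}^d)}d_B(X,\psi(Y)),$$ with values in $[0,\infty]$, where $\mathrm{Iso}(\mathbb{R}^d)$ is the group of all isometries of $\mathbb{R}^d$ and the infimum is $\infty$ if no bijection exists. **Theorem.** For all $X,Y\in\mathrm{PPS}(\mathbb{R}^d)$ the following are equivalent: (a) $d_{EB}(X,Y)<\infty$; (b) $d_B(X,Y)<\infty$; (c) $\operatorname{den}(X)=\operatorname{den}(Y)$. Moreover, for every $X\in\mathrm{PPS}(\mathbb{R}^d)$, $$\{Y\in \mathrm{PPS}(\mathbb{R}^d)\mid d_{EB}(X,Y)<\infty\}=\{Y\in \mathrm{PPS}(\mathbb{R}^d)\mid d_B(X,Y)<\infty\}=\mathrm{PPS}(\mathbb{R}^d,\operatorname{den}(X)).$$ -/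

import Mathlib

open scoped Pointwise ENNReal

/-- `(b, P)` represents `X`: the vectors `b` generate the lattice `Λ = ℤ b₁ + ⋯ + ℤ b_d`, the motif
`P` is a non-empty finite subset of the half-open unit cell `U(Λ) = {∑ tᵢ bᵢ | tᵢ ∈ [0, 1)}`,
and `X` is the Minkowski sum `Λ + P`. -/
def IsRepresentation {d : ℕ} (X : Set (EuclideanSpace ℝ (Fin d)))
    (b : Module.Basis (Fin d) ℝ (EuclideanSpace ℝ (Fin d)))
    (P : Finset (EuclideanSpace ℝ (Fin d))) : Prop :=
  P.Nonempty ∧ (P : Set (EuclideanSpace ℝ (Fin d))) ⊆ ZSpan.fundamentalDomain b ∧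
    X = (Submodule.span ℤ (Set.range b) : Set (EuclideanSpace ℝ (Fin d))) + P

/-- The family of all periodic point sets of `ℝ^d`. -/
def PPS (d : ℕ) : Type :=
  {X : Set (EuclideanSpace ℝ (Fin d)) // ∃ b P, IsRepresentation X b P}

/-- The set of points of a periodic point set. -/
def PPS.points {d : ℕ} (X : PPS d) : Set (EuclideanSpace ℝ (Fin d)) := X.1

/-- The volume of the unit cell of the lattice generated by `b`. -/
noncomputable def unitCellVolume {d : ℕ}
    (b : Module.Basis (Fin d) ℝ (EuclideanSpace ℝ (Fin d))) : ℝ :=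
  MeasureTheory.volume.real (ZSpan.fundamentalDomain b)

/-- The density `|P| / Vol(U(Λ))` of a periodic point set, computed from some choice of
representatives; `PPS.den_eq` shows that the choice does not matter. -/
noncomputable def PPS.den {d : ℕ} (X : PPS d) : ℝ :=
  (X.2.choose_spec.choose.card : ℝ) / unitCellVolume X.2.choose

/-- Bottleneck distance of two subsets of `ℝ^d`. It is `∞` if there is no bijection. -/
noncomputable def dB {d : ℕ} (X Y : Set (EuclideanSpace ℝ (Fin d))) : ℝ≥0∞ :=
  ⨅ f : X ≃ Y, ⨆ x : X, edist (x : EuclideanSpace ℝ (Fin d)) (f x)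

/-- Euclidean bottleneck distance of two subsets of `ℝ^d`. -/
noncomputable def dEB {d : ℕ} (X Y : Set (EuclideanSpace ℝ (Fin d))) : ℝ≥0∞ :=
  ⨅ ψ : EuclideanSpace ℝ (Fin d) ≃ᵢ EuclideanSpace ℝ (Fin d), dB X (ψ '' Y)

/-- The large-scale connected component of `x` in a space with extended pseudo-metric `ρ`. -/
def largeScaleComponent {α : Type} (ρ : α → α → ℝ≥0∞) (x : α) : Set α := {y | ρ x y < ∞}

/-- The periodic point sets of `ℝ^d` of density `κ`. -/
def PPSOfDensity (d : ℕ) (κ : ℝ) : Set (PPS d) := {X | X.den = κ}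

section WellDefined

open MeasureTheory Metric

variable {d : ℕ} {X : Set (EuclideanSpace ℝ (Fin d))}
  {b : Module.Basis (Fin d) ℝ (EuclideanSpace ℝ (Fin d))} {P : Finset (EuclideanSpace ℝ (Fin d))}

theorem unitCellVolume_pos (b : Module.Basis (Fin d) ℝ (EuclideanSpace ℝ (Fin d))) :
    0 < unitCellVolume b := by
  refine ENNReal.toReal_pos (ZSpan.measure_fundamentalDomain_ne_zero b) ?_
  exact (ZSpan.fundamentalDomain_isBounded b).measure_lt_top.ne

theorem exists_norm_le_of_mem_fundamentalDomain
    (b : Module.Basis (Fin d) ℝ (EuclideanSpace ℝ (Fin d))) :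
    ∃ s : ℝ, 0 ≤ s ∧ ∀ x ∈ ZSpan.fundamentalDomain b, ‖x‖ ≤ s := by
  obtain ⟨s, hs, h⟩ := (ZSpan.fundamentalDomain_isBounded b).exists_pos_norm_le
  exact ⟨s, hs.le, h⟩

theorem finite_lattice_translates (b : Module.Basis (Fin d) ℝ (EuclideanSpace ℝ (Fin d)))
    (p : EuclideanSpace ℝ (Fin d)) (R : ℝ) :
    {l : Submodule.span ℤ (Set.range b) | ‖(l : EuclideanSpace ℝ (Fin d)) + p‖ ≤ R}.Finite := by
  refine Set.Finite.of_finite_image (f := Subtype.val) ?_ Subtype.val_injective.injOn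
  refine (ZSpan.setFinite_inter b (s := closedBall (-p) R) isBounded_closedBall).subset ?_
  rintro _ ⟨l, hl, rfl⟩
  refine ⟨?_, l.2⟩
  simpa [mem_closedBall, dist_eq_norm] using hl

theorem measure_translate_fundamentalDomain
    (b : Module.Basis (Fin d) ℝ (EuclideanSpace ℝ (Fin d))) (v : EuclideanSpace ℝ (Fin d)) :
    volume (v +ᵥ ZSpan.fundamentalDomain b) = ENNReal.ofReal (unitCellVolume b) := by
  rw [measure_vadd, unitCellVolume, measureReal_def, ENNReal.ofReal_toReal]
  exact (ZSpan.fundamentalDomain_isBounded b).measure_lt_top.ne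

theorem volume_ball_le_card_mul (b : Module.Basis (Fin d) ℝ (EuclideanSpace ℝ (Fin d))) {s : ℝ}
    (hs : ∀ x ∈ ZSpan.fundamentalDomain b, ‖x‖ ≤ s) (p : EuclideanSpace ℝ (Fin d)) (R : ℝ) :
    volume (closedBall (0 : EuclideanSpace ℝ (Fin d)) R) ≤
      (finite_lattice_translates b p (R + s)).toFinset.card *
        ENNReal.ofReal (unitCellVolume b) := by
  have hsub : closedBall (0 : EuclideanSpace ℝ (Fin d)) R ⊆
      ⋃ l ∈ (finite_lattice_translates b p (R + s)).toFinset,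
        ((l : EuclideanSpace ℝ (Fin d)) + p) +ᵥ ZSpan.fundamentalDomain b := by
    intro y hy
    have hf := ZSpan.fract_mem_fundamentalDomain b (y - p)
    have hdec : y = ((ZSpan.floor b (y - p) : EuclideanSpace ℝ (Fin d)) + p) +
        ZSpan.fract b (y - p) := by
      rw [ZSpan.fract_apply]; abel
    simp only [Set.mem_iUnion]
    refine ⟨ZSpan.floor b (y - p), ?_, ?_⟩
    · simp only [Set.Finite.mem_toFinset, Set.mem_ofPred_eq]
      have h1 : (ZSpan.floor b (y - p) : EuclideanSpace ℝ (Fin d)) + p =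
          y - ZSpan.fract b (y - p) := by rw [ZSpan.fract_apply]; abel
      rw [h1]
      refine (norm_sub_le _ _).trans (add_le_add ?_ (hs _ hf))
      simpa using hy
    · rw [Set.mem_vadd_set]
      exact ⟨_, hf, hdec.symm⟩
  refine (measure_mono hsub).trans ((measure_biUnion_finset_le _ _).trans ?_)
  simp only [measure_translate_fundamentalDomain, Finset.sum_const, nsmul_eq_mul, le_refl]

theorem card_mul_le_volume_ball (b : Module.Basis (Fin d) ℝ (EuclideanSpace ℝ (Fin d))) {s : ℝ}
    (hs : ∀ x ∈ ZSpan.fundamentalDomain b, ‖x‖ ≤ s) (p : EuclideanSpace ℝ (Fin d)) (R : ℝ) :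
    (finite_lattice_translates b p R).toFinset.card * ENNReal.ofReal (unitCellVolume b) ≤
      volume (closedBall (0 : EuclideanSpace ℝ (Fin d)) (R + s)) := by
  have hmeas : ∀ v : EuclideanSpace ℝ (Fin d),
      MeasurableSet (v +ᵥ ZSpan.fundamentalDomain b) := fun v =>
    (ZSpan.fundamentalDomain_measurableSet b).const_vadd v
  have hdisj : Set.PairwiseDisjoint
      ((finite_lattice_translates b p R).toFinset : Set (Submodule.span ℤ (Set.range b)))
      (fun l => ((l : EuclideanSpace ℝ (Fin d)) + p) +ᵥ ZSpan.fundamentalDomain b) := by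
    intro l _ m _ hlm
    refine Set.disjoint_left.2 fun y hy hy' => hlm ?_
    obtain ⟨u, hu, rfl⟩ := Set.mem_vadd_set.1 hy
    obtain ⟨v, hv, hvu⟩ := Set.mem_vadd_set.1 hy'
    have h := hvu
    simp only [vadd_eq_add] at h
    have huv : u = v := by
      rw [← ZSpan.fract_eq_self.2 hu, ← ZSpan.fract_eq_self.2 hv, ZSpan.fract_eq_fract]
      have : -u + v = ((l - m : Submodule.span ℤ (Set.range b)) : EuclideanSpace ℝ (Fin d)) := by
        rw [Submodule.coe_sub]
        have h2 : v = (l : EuclideanSpace ℝ (Fin d)) + p + u - (m + p) := by rw [← h]; abel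
        rw [h2]; abel
      rw [this]; exact (l - m).2
    subst huv
    exact Subtype.ext (add_right_cancel (add_right_cancel h)).symm
  have hsub : (⋃ l ∈ (finite_lattice_translates b p R).toFinset,
        ((l : EuclideanSpace ℝ (Fin d)) + p) +ᵥ ZSpan.fundamentalDomain b) ⊆
      closedBall (0 : EuclideanSpace ℝ (Fin d)) (R + s) := by
    intro y hy
    simp only [Set.mem_iUnion] at hy
    obtain ⟨l, hl, hy⟩ := hy
    obtain ⟨u, hu, rfl⟩ := Set.mem_vadd_set.1 hy
    simp only [Set.Finite.mem_toFinset, Set.mem_ofPred_eq] at hl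
    simpa using (norm_add_le _ _).trans (add_le_add hl (hs u hu))
  refine le_trans (le_of_eq ?_) (measure_mono hsub)
  rw [measure_biUnion_finset hdisj fun l _ => hmeas _]
  simp only [measure_translate_fundamentalDomain, Finset.sum_const, nsmul_eq_mul]

theorem IsRepresentation.ncard_inter (h : IsRepresentation X b P) (R : ℝ) :
    (X ∩ closedBall 0 R).ncard = ∑ p ∈ P, (finite_lattice_translates b p R).toFinset.card := by
  classical
  rw [← Finset.card_sigma, ← Set.ncard_coe_finset]
  symm
  refine Set.ncard_congr (fun q _ => (q.2 : EuclideanSpace ℝ (Fin d)) + q.1) ?_ ?_ ?_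
  · rintro ⟨p, l⟩ hq
    simp only [Finset.coe_sigma, Set.mem_sigma_iff, Finset.mem_coe, Set.Finite.mem_toFinset,
      Set.mem_ofPred_eq] at hq
    refine ⟨?_, by simpa using hq.2⟩
    rw [h.2.2]
    exact Set.add_mem_add l.2 hq.1
  · rintro ⟨p, l⟩ ⟨q, m⟩ hp hq heq
    simp only [Finset.coe_sigma, Set.mem_sigma_iff, Finset.mem_coe, Set.Finite.mem_toFinset,
      Set.mem_ofPred_eq] at hp hq heq
    have hpq : p = q := by
      rw [← ZSpan.fract_eq_self.2 (h.2.1 hp.1), ← ZSpan.fract_eq_self.2 (h.2.1 hq.1),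
        ZSpan.fract_eq_fract]
      have : -p + q = ((l - m : Submodule.span ℤ (Set.range b)) : EuclideanSpace ℝ (Fin d)) := by
        rw [Submodule.coe_sub]
        have h2 : q = (l : EuclideanSpace ℝ (Fin d)) + p - m := by rw [heq]; abel
        rw [h2]; abel
      rw [this]; exact (l - m).2
    subst hpq
    have : l = m := Subtype.ext (add_right_cancel heq)
    rw [this]
  · rintro x ⟨hx, hxR⟩
    rw [h.2.2] at hx
    obtain ⟨l, hl, p, hp, rfl⟩ := Set.mem_add.1 hx
    refine ⟨⟨p, ⟨l, hl⟩⟩, ?_, rfl⟩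
    simp only [Finset.coe_sigma, Set.mem_sigma_iff, Finset.mem_coe, Set.Finite.mem_toFinset,
      Set.mem_ofPred_eq]
    exact ⟨hp, by simpa using hxR⟩

theorem IsRepresentation.card_mul_volume_ball_le (h : IsRepresentation X b P) {s : ℝ}
    (hs : ∀ x ∈ ZSpan.fundamentalDomain b, ‖x‖ ≤ s) (R : ℝ) :
    P.card * volume.real (closedBall (0 : EuclideanSpace ℝ (Fin d)) R) ≤
      (X ∩ closedBall 0 (R + s)).ncard * unitCellVolume b := by
  rw [h.ncard_inter, Nat.cast_sum, Finset.sum_mul, ← nsmul_eq_mul]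
  refine Finset.card_nsmul_le_sum _ _ _ fun p _ => ?_
  have := ENNReal.toReal_mono (by finiteness) (volume_ball_le_card_mul b hs p R)
  simpa [ENNReal.toReal_mul, ENNReal.toReal_ofReal (unitCellVolume_pos b).le,
    measureReal_def] using this

theorem IsRepresentation.ncard_mul_le (h : IsRepresentation X b P) {s : ℝ}
    (hs : ∀ x ∈ ZSpan.fundamentalDomain b, ‖x‖ ≤ s) (R : ℝ) :
    (X ∩ closedBall 0 R).ncard * unitCellVolume b ≤
      P.card * volume.real (closedBall (0 : EuclideanSpace ℝ (Fin d)) (R + s)) := by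
  rw [h.ncard_inter, Nat.cast_sum, Finset.sum_mul, ← nsmul_eq_mul]
  refine Finset.sum_le_card_nsmul _ _ _ fun p _ => ?_
  have := ENNReal.toReal_mono measure_closedBall_lt_top.ne (card_mul_le_volume_ball b hs p R)
  simpa [ENNReal.toReal_mul, ENNReal.toReal_ofReal (unitCellVolume_pos b).le,
    measureReal_def] using this

theorem IsRepresentation.div_le_div (h : IsRepresentation X b P)
    {b' : Module.Basis (Fin d) ℝ (EuclideanSpace ℝ (Fin d))}
    {P' : Finset (EuclideanSpace ℝ (Fin d))} (h' : IsRepresentation X b' P') :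
    (P.card : ℝ) / unitCellVolume b ≤ P'.card / unitCellVolume b' := by
  obtain ⟨s, hs0, hs⟩ := exists_norm_le_of_mem_fundamentalDomain b
  obtain ⟨s', hs0', hs'⟩ := exists_norm_le_of_mem_fundamentalDomain b'
  have hV := unitCellVolume_pos b
  have hV' := unitCellVolume_pos b'
  set ω := volume.real (closedBall (0 : EuclideanSpace ℝ (Fin d)) 1) with hω
  have hω0 : 0 < ω :=
    ENNReal.toReal_pos (measure_closedBall_pos _ _ one_pos).ne' measure_closedBall_lt_top.ne
  have hball : ∀ R : ℝ, 0 ≤ R →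
      volume.real (closedBall (0 : EuclideanSpace ℝ (Fin d)) R) = R ^ d * ω := by
    intro R hR
    rw [measureReal_def, Measure.addHaar_closedBall' _ _ hR, ENNReal.toReal_mul,
      ENNReal.toReal_ofReal (by positivity), hω, measureReal_def]
    simp
  have key : ∀ R : ℝ, 0 < R → (P.card : ℝ) / unitCellVolume b ≤
      P'.card / unitCellVolume b' * (1 + (s + s') / R) ^ d := by
    intro R hR
    have h1 := h.card_mul_volume_ball_le hs R
    have h2 := h'.ncard_mul_le hs' (R + s)
    rw [hball R hR.le] at h1
    rw [hball _ (by positivity)] at h2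
    rw [← div_le_iff₀ hV] at h1
    rw [← le_div_iff₀ hV'] at h2
    have h3 := h1.trans h2
    have h4 : (R + s + s') ^ d = (1 + (s + s') / R) ^ d * R ^ d := by
      rw [← mul_pow]; congr 1; field_simp; ring
    rw [h4] at h3
    refine le_of_mul_le_mul_right ?_ (show 0 < R ^ d * ω by positivity)
    calc _ = (P.card : ℝ) * (R ^ d * ω) / unitCellVolume b := by ring
      _ ≤ _ := h3
      _ = _ := by ring
  have hlim : Filter.Tendsto (fun R : ℝ => P'.card / unitCellVolume b' * (1 + (s + s') / R) ^ d)
      Filter.atTop (nhds (P'.card / unitCellVolume b' * (1 + 0) ^ d)) :=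
    ((Filter.Tendsto.const_div_atTop Filter.tendsto_id _).const_add 1 |>.pow d).const_mul _
  rw [add_zero, one_pow, mul_one] at hlim
  refine ge_of_tendsto hlim ?_
  filter_upwards [Filter.eventually_gt_atTop 0] with R hR using key R hR

/-- The density does not depend on the choice of the representatives. -/
theorem PPS.den_eq (X : PPS d) (h : IsRepresentation X.points b P) :
    X.den = P.card / unitCellVolume b :=
  le_antisymm (IsRepresentation.div_le_div X.2.choose_spec.choose_spec h)
    (IsRepresentation.div_le_div h X.2.choose_spec.choose_spec)

end WellDefined

/-! ### Bounded displacement forces equal density -/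

section BoundedDisplacement

open MeasureTheory Metric

variable {d : ℕ} {X Y : Set (EuclideanSpace ℝ (Fin d))}
  {b b' : Module.Basis (Fin d) ℝ (EuclideanSpace ℝ (Fin d))}
  {P P' : Finset (EuclideanSpace ℝ (Fin d))}

/-! Density is the asymptotic number of points per unit of volume in large balls. A bijection that
moves points by at most `C` changes the radius of such a ball by at most `C`, which does not affect
the limit; an isometry `ψ` only adds the constant `‖ψ 0‖`. Hence a finite Euclidean bottleneck
distance forces equal densities (`PPS.den_eq_of_dEB_lt_top`).

Conversely, tile space by the cells of each lattice and join `x` in `X` to `y` in `Y` when their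
cells meet. Cells are bounded, so joined points are uniformly close. Hall's condition is a double
count. Let `N` contain all neighbours of a finite set `A`. For each `z`, if the first-lattice cell
of `z` contains a point of `A`, then all `|P'|` points of `Y` in the second-lattice cell of `z` lie
in `N`, while `A` has at most `|P|` points in the first cell. Integrating over `z` weights each
point by the volume of its cell, and equality of densities gives `|A| ≤ |N|`
(`IsRepresentation.card_le_card_of_cellsMeet`). Hall's theorem then gives injections in both
directions, and Schröder–Bernstein merges them into a bijection along the relation. -/

theorem IsRepresentation.finite_inter_closedBall (h : IsRepresentation X b P) (R : ℝ) :
    (X ∩ closedBall 0 R).Finite := by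
  refine (P.finite_toSet.biUnion fun p _ => (finite_lattice_translates b p R).image
    fun l : Submodule.span ℤ (Set.range b) => (l : EuclideanSpace ℝ (Fin d)) + p).subset ?_
  rintro x ⟨hx, hxR⟩
  rw [h.2.2] at hx
  obtain ⟨l, hl, p, hp, rfl⟩ := Set.mem_add.1 hx
  exact Set.mem_biUnion hp ⟨⟨l, hl⟩, by simpa using hxR, rfl⟩

/-- An injection that increases norms by at most a constant does not decrease the density. -/
theorem IsRepresentation.div_le_div_of_injective (h : IsRepresentation X b P)
    (h' : IsRepresentation Y b' P') {f : X → Y} (hf : Function.Injective f) {C : ℝ} (hC : 0 ≤ C)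
    (hfC : ∀ x, ‖(f x : EuclideanSpace ℝ (Fin d))‖ ≤ ‖(x : EuclideanSpace ℝ (Fin d))‖ + C) :
    (P.card : ℝ) / unitCellVolume b ≤ P'.card / unitCellVolume b' := by
  classical
  obtain ⟨s, hs0, hs⟩ := exists_norm_le_of_mem_fundamentalDomain b
  obtain ⟨s', hs0', hs'⟩ := exists_norm_le_of_mem_fundamentalDomain b'
  have hV := unitCellVolume_pos b
  have hV' := unitCellVolume_pos b'
  set ω := volume.real (closedBall (0 : EuclideanSpace ℝ (Fin d)) 1) with hω
  have hω0 : 0 < ω :=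
    ENNReal.toReal_pos (measure_closedBall_pos _ _ one_pos).ne' measure_closedBall_lt_top.ne
  have hball : ∀ R : ℝ, 0 ≤ R →
      volume.real (closedBall (0 : EuclideanSpace ℝ (Fin d)) R) = R ^ d * ω := by
    intro R hR
    rw [measureReal_def, Measure.addHaar_closedBall' _ _ hR, ENNReal.toReal_mul,
      ENNReal.toReal_ofReal (by positivity), hω, measureReal_def]
    simp
  have hcount : ∀ R : ℝ, (X ∩ closedBall 0 R).ncard ≤ (Y ∩ closedBall 0 (R + C)).ncard := by
    intro R
    -- The value `x` outside `X` is a dummy, never used on the ball's part of `X`.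
    refine Set.ncard_le_ncard_of_injOn (fun x => if hx : x ∈ X then (f ⟨x, hx⟩ : _) else x) ?_ ?_
      (h'.finite_inter_closedBall _)
    · rintro x ⟨hx, hxR⟩
      simp only [hx, dif_pos]
      refine ⟨(f ⟨x, hx⟩).2, mem_closedBall_zero_iff.2 ((hfC ⟨x, hx⟩).trans ?_)⟩
      exact add_le_add_left (mem_closedBall_zero_iff.1 hxR) C
    · rintro x ⟨hx, -⟩ y ⟨hy, -⟩ hxy
      simp only [hx, hy, dif_pos] at hxy
      exact congrArg Subtype.val (hf (Subtype.ext hxy))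
  -- The ball grows by `s` so that translated cells cover it, by `C` for the displacement, and by
  -- `s'` so that the cells counted for `Y` fit inside. The relative error vanishes as `R` grows.
  have key : ∀ R : ℝ, 0 < R → (P.card : ℝ) / unitCellVolume b ≤
      P'.card / unitCellVolume b' * (1 + (s + C + s') / R) ^ d := by
    intro R hR
    have h1 := h.card_mul_volume_ball_le hs R
    have h2 := h'.ncard_mul_le hs' (R + s + C)
    rw [hball R hR.le] at h1
    rw [hball _ (by positivity)] at h2
    rw [← div_le_iff₀ hV] at h1
    rw [← le_div_iff₀ hV'] at h2
    have h3 := (h1.trans (Nat.cast_le.2 (hcount (R + s)))).trans h2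
    have h4 : (R + s + C + s') ^ d = (1 + (s + C + s') / R) ^ d * R ^ d := by
      rw [← mul_pow]; congr 1; field_simp; ring
    rw [h4] at h3
    refine le_of_mul_le_mul_right ?_ (show 0 < R ^ d * ω by positivity)
    calc _ = (P.card : ℝ) * (R ^ d * ω) / unitCellVolume b := by ring
      _ ≤ _ := h3
      _ = _ := by ring
  have hlim : Filter.Tendsto
      (fun R : ℝ => P'.card / unitCellVolume b' * (1 + (s + C + s') / R) ^ d)
      Filter.atTop (nhds (P'.card / unitCellVolume b' * (1 + 0) ^ d)) :=
    ((Filter.Tendsto.const_div_atTop Filter.tendsto_id _).const_add 1 |>.pow d).const_mul _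
  rw [add_zero, one_pow, mul_one] at hlim
  refine ge_of_tendsto hlim ?_
  filter_upwards [Filter.eventually_gt_atTop 0] with R hR using key R hR

theorem PPS.den_le_of_injective (X Y : PPS d) {f : X.points → Y.points}
    (hf : Function.Injective f) {C : ℝ} (hC : 0 ≤ C)
    (hfC : ∀ x, ‖(f x : EuclideanSpace ℝ (Fin d))‖ ≤ ‖(x : EuclideanSpace ℝ (Fin d))‖ + C) :
    X.den ≤ Y.den := by
  obtain ⟨b, P, h⟩ := X.2
  obtain ⟨b', P', h'⟩ := Y.2
  rw [X.den_eq h, Y.den_eq h']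
  exact IsRepresentation.div_le_div_of_injective h h' hf hC hfC

theorem exists_equiv_of_dB_lt_top (h : dB X Y < ∞) :
    ∃ (f : X ≃ Y) (C : ℝ), 0 ≤ C ∧ ∀ x : X, dist (x : EuclideanSpace ℝ (Fin d)) (f x) ≤ C := by
  obtain ⟨f, hf⟩ := iInf_lt_iff.1 h
  refine ⟨f, (⨆ x : X, edist (x : EuclideanSpace ℝ (Fin d)) (f x)).toReal,
    ENNReal.toReal_nonneg, fun x => ?_⟩
  rw [dist_edist]
  exact ENNReal.toReal_mono hf.ne
    (le_iSup (fun x : X => edist (x : EuclideanSpace ℝ (Fin d)) (f x)) x)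

theorem PPS.den_eq_of_dEB_lt_top (X Y : PPS d) (h : dEB X.points Y.points < ∞) :
    X.den = Y.den := by
  obtain ⟨ψ, hψ⟩ := iInf_lt_iff.1 h
  obtain ⟨f, C, hC, hf⟩ := exists_equiv_of_dB_lt_top hψ
  let g : X.points ≃ Y.points := f.trans (ψ.toEquiv.image Y.points).symm
  have hg : ∀ x : X.points, dist (x : EuclideanSpace ℝ (Fin d)) (ψ (g x)) ≤ C := by
    intro x
    have hx : ψ (g x) = f x :=
      congrArg Subtype.val ((ψ.toEquiv.image Y.points).apply_symm_apply (f x))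
    rw [hx]
    exact hf x
  -- `ψ` need not fix the origin, so norms are compared through `ψ 0`; this is the source of the
  -- constant `C + ‖ψ 0‖`.
  have hψ0 : ∀ y, dist (ψ y) (ψ 0) = ‖y‖ := fun y => by rw [ψ.dist_eq, dist_zero_right]
  refine le_antisymm
    (PPS.den_le_of_injective X Y g.injective (add_nonneg hC (norm_nonneg (ψ 0))) fun x => ?_)
    (PPS.den_le_of_injective Y X g.symm.injective (add_nonneg hC (norm_nonneg (ψ 0)))
      fun y => ?_)
  · rw [← hψ0, ← dist_zero_right (x : EuclideanSpace ℝ (Fin d)), ← dist_zero_left (ψ 0)]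
    have h1 := dist_triangle4 (ψ (g x)) (x : EuclideanSpace ℝ (Fin d)) 0 (ψ 0)
    have h2 := hg x
    rw [dist_comm] at h2
    linarith
  · have h2 := hg (g.symm y)
    rw [g.apply_symm_apply] at h2
    rw [← hψ0 y, ← dist_zero_right (g.symm y : EuclideanSpace ℝ (Fin d)),
      ← dist_zero_right (ψ 0)]
    have h1 := dist_triangle4 (g.symm y : EuclideanSpace ℝ (Fin d)) (ψ y) (ψ 0) 0
    linarith

theorem dEB_le_dB (X Y : Set (EuclideanSpace ℝ (Fin d))) : dEB X Y ≤ dB X Y := by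
  refine (iInf_le _ (IsometryEquiv.refl _)).trans_eq ?_
  exact congrArg (dB X) (Set.image_id Y)

end BoundedDisplacement

/-! ### Equal density yields a bounded matching -/

section Matching

open MeasureTheory Metric

variable {d : ℕ} {X Y : Set (EuclideanSpace ℝ (Fin d))}
  {b b' : Module.Basis (Fin d) ℝ (EuclideanSpace ℝ (Fin d))}
  {P P' : Finset (EuclideanSpace ℝ (Fin d))}

/-- The cell of the lattice tiling generated by `b` containing `x` meets the cell of the lattice
tiling generated by `b'` containing `y`. -/
def CellsMeet (b b' : Module.Basis (Fin d) ℝ (EuclideanSpace ℝ (Fin d)))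
    (x y : EuclideanSpace ℝ (Fin d)) : Prop :=
  ∃ z, ZSpan.floor b z = ZSpan.floor b x ∧ ZSpan.floor b' z = ZSpan.floor b' y

theorem CellsMeet.symm {x y : EuclideanSpace ℝ (Fin d)} (h : CellsMeet b b' x y) :
    CellsMeet b' b y x :=
  h.imp fun _ hz => ⟨hz.2, hz.1⟩

theorem norm_sub_le_of_floor_eq {s : ℝ} (hs : ∀ x ∈ ZSpan.fundamentalDomain b, ‖x‖ ≤ s)
    {x z : EuclideanSpace ℝ (Fin d)} (h : ZSpan.floor b z = ZSpan.floor b x) :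
    ‖x - z‖ ≤ s + s := by
  have hxz : x - z = ZSpan.fract b x - ZSpan.fract b z := by
    rw [ZSpan.fract_apply, ZSpan.fract_apply, h]; abel
  rw [hxz]
  exact (norm_sub_le _ _).trans (add_le_add (hs _ (ZSpan.fract_mem_fundamentalDomain b x))
    (hs _ (ZSpan.fract_mem_fundamentalDomain b z)))

/-- A common point `z` of the two cells is within one cell diameter of each of `x` and `y`. This
uniform bound turns any matching along `CellsMeet` into one of bounded displacement. -/
theorem exists_norm_sub_le_of_cellsMeet
    (b b' : Module.Basis (Fin d) ℝ (EuclideanSpace ℝ (Fin d))) :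
    ∃ C : ℝ, ∀ x y, CellsMeet b b' x y → ‖x - y‖ ≤ C := by
  obtain ⟨s, -, hs⟩ := exists_norm_le_of_mem_fundamentalDomain b
  obtain ⟨s', -, hs'⟩ := exists_norm_le_of_mem_fundamentalDomain b'
  refine ⟨s + s + (s' + s'), fun x y ⟨z, hx, hy⟩ => ?_⟩
  refine (norm_sub_le_norm_sub_add_norm_sub x z y).trans
    (add_le_add (norm_sub_le_of_floor_eq hs hx) ?_)
  rw [norm_sub_rev]
  exact norm_sub_le_of_floor_eq hs' hy

theorem setOf_floor_eq (b : Module.Basis (Fin d) ℝ (EuclideanSpace ℝ (Fin d)))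
    (x : EuclideanSpace ℝ (Fin d)) :
    {z | ZSpan.floor b z = ZSpan.floor b x} =
      (ZSpan.floor b x : EuclideanSpace ℝ (Fin d)) +ᵥ ZSpan.fundamentalDomain b := by
  ext z
  rw [Set.mem_vadd_set_iff_neg_vadd_mem, ← Submodule.coe_neg]
  refine (eq_comm.trans ?_).trans
    (ZSpan.vadd_mem_fundamentalDomain b (-ZSpan.floor b x) z).symm
  rw [neg_inj]

/-- In a periodic point set, each cell contains as many points as the motif. -/
theorem IsRepresentation.ncard_floor_eq (h : IsRepresentation X b P)
    (z : EuclideanSpace ℝ (Fin d)) :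
    {x ∈ X | ZSpan.floor b x = ZSpan.floor b z}.ncard = P.card := by
  have himage : {x ∈ X | ZSpan.floor b x = ZSpan.floor b z} =
      (fun p => (ZSpan.floor b z : EuclideanSpace ℝ (Fin d)) + p) '' P := by
    -- Since `p` lies in the fundamental domain it is its own fractional part, leaving `l` as the
    -- lattice part.
    have hfl : ∀ l ∈ Submodule.span ℤ (Set.range b), ∀ p ∈ P,
        (ZSpan.floor b (l + p) : EuclideanSpace ℝ (Fin d)) = l := by
      intro l hl p hp
      have h1 := ZSpan.fract_apply b (l + p)
      rw [ZSpan.fract_zSpan_add b p hl, ZSpan.fract_eq_self.2 (h.2.1 hp)] at h1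
      rw [eq_sub_iff_add_eq, add_comm l p] at h1
      rw [add_comm l p]
      exact add_left_cancel h1
    ext x
    constructor
    · rintro ⟨hx, hxz⟩
      rw [h.2.2] at hx
      obtain ⟨l, hl, p, hp, rfl⟩ := Set.mem_add.1 hx
      refine ⟨p, hp, ?_⟩
      simp only [← hxz]
      rw [hfl l hl p hp]
    · rintro ⟨p, hp, rfl⟩
      refine ⟨?_, Subtype.ext (hfl _ (ZSpan.floor b z).2 p hp)⟩
      rw [h.2.2]
      exact Set.add_mem_add (ZSpan.floor b z).2 hp
  rw [himage, Set.ncard_image_of_injective _ (add_right_injective _), Set.ncard_coe_finset]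

/-- Double counting: each `x` in `A` contributes the indicator of its own cell, whose integral is
the cell volume. -/
theorem lintegral_card_floor_eq (b : Module.Basis (Fin d) ℝ (EuclideanSpace ℝ (Fin d)))
    (A : Finset (EuclideanSpace ℝ (Fin d))) [∀ z, DecidablePred fun x =>
      ZSpan.floor b x = ZSpan.floor b z] :
    ∫⁻ z, ((A.filter fun x => ZSpan.floor b x = ZSpan.floor b z).card : ℝ≥0∞) =
      A.card * ENNReal.ofReal (unitCellVolume b) := by
  have hmeas : ∀ x, MeasurableSet {z | ZSpan.floor b z = ZSpan.floor b x} := fun x => by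
    rw [setOf_floor_eq]
    exact (ZSpan.fundamentalDomain_measurableSet b).const_vadd _
  have hsum : ∀ z, ((A.filter fun x => ZSpan.floor b x = ZSpan.floor b z).card : ℝ≥0∞) =
      ∑ x ∈ A, {z | ZSpan.floor b z = ZSpan.floor b x}.indicator 1 z := by
    intro z
    rw [Finset.card_filter, Nat.cast_sum]
    refine Finset.sum_congr rfl fun x _ => ?_
    by_cases hx : ZSpan.floor b x = ZSpan.floor b z
    · simp [hx]
    · simp [hx, Ne.symm hx]
  simp_rw [hsum]
  rw [lintegral_finsetSum _ fun x _ => measurable_one.indicator (hmeas x)]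
  simp_rw [lintegral_indicator_one (hmeas _), setOf_floor_eq, measure_translate_fundamentalDomain]
  simp

/-- Hall's condition for the relation `CellsMeet`. -/
theorem IsRepresentation.card_le_card_of_cellsMeet (h : IsRepresentation X b P)
    (h' : IsRepresentation Y b' P')
    (hden : (P.card : ℝ) / unitCellVolume b = P'.card / unitCellVolume b')
    {A N : Finset (EuclideanSpace ℝ (Fin d))} (hA : (A : Set (EuclideanSpace ℝ (Fin d))) ⊆ X)
    (hN : ∀ x ∈ A, ∀ y ∈ Y, CellsMeet b b' x y → y ∈ N) : A.card ≤ N.card := by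
  classical
  have hV := unitCellVolume_pos b
  have hV' := unitCellVolume_pos b'
  have hP : 0 < P.card := h.1.card_pos
  -- The count at a single point `z`: once some `x` in `A` shares its first cell, `z` itself
  -- witnesses that `x` is joined to every point of `Y` in its second cell.
  have hpt : ∀ z, P'.card * (A.filter fun x => ZSpan.floor b x = ZSpan.floor b z).card ≤
      P.card * (N.filter fun y => ZSpan.floor b' y = ZSpan.floor b' z).card := by
    intro z
    rcases (A.filter fun x => ZSpan.floor b x = ZSpan.floor b z).eq_empty_or_nonempty with h0 | hne
    · simp [h0]
    obtain ⟨x, hx⟩ := hne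
    rw [Finset.mem_filter] at hx
    have hfin : {x ∈ X | ZSpan.floor b x = ZSpan.floor b z}.Finite :=
      -- An infinite set has `ncard` zero, so a positive value certifies finiteness.
      Set.finite_of_ncard_pos (by rw [h.ncard_floor_eq]; exact hP)
    have h1 : (A.filter fun x => ZSpan.floor b x = ZSpan.floor b z).card ≤ P.card := by
      rw [← h.ncard_floor_eq z, ← Set.ncard_coe_finset]
      refine Set.ncard_le_ncard (fun u hu => ?_) hfin
      have hu := Finset.mem_filter.1 (Finset.mem_coe.1 hu)
      exact ⟨hA hu.1, hu.2⟩
    have h2 : P'.card ≤ (N.filter fun y => ZSpan.floor b' y = ZSpan.floor b' z).card := by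
      rw [← h'.ncard_floor_eq z, ← Set.ncard_coe_finset]
      refine Set.ncard_le_ncard (fun y hy => ?_) (Finset.finite_toSet _)
      exact Finset.mem_coe.2 (Finset.mem_filter.2
        ⟨hN x hx.1 y hy.1 ⟨z, hx.2.symm, hy.2.symm⟩, hy.2⟩)
    rw [mul_comm]
    exact Nat.mul_le_mul h1 h2
  have hint : (P'.card : ℝ≥0∞) * (A.card * ENNReal.ofReal (unitCellVolume b)) ≤
      P.card * (N.card * ENNReal.ofReal (unitCellVolume b')) := by
    rw [← lintegral_card_floor_eq, ← lintegral_card_floor_eq,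
      ← lintegral_const_mul' _ _ (by simp), ← lintegral_const_mul' _ _ (by simp)]
    refine lintegral_mono fun z => ?_
    rw [← Nat.cast_mul, ← Nat.cast_mul, Nat.cast_le]
    convert hpt z
  have hreal := ENNReal.toReal_mono (by finiteness) hint
  simp only [ENNReal.toReal_mul, ENNReal.toReal_natCast, ENNReal.toReal_ofReal hV.le,
    ENNReal.toReal_ofReal hV'.le] at hreal
  rw [div_eq_div_iff hV.ne' hV'.ne'] at hden
  have hpos : 0 < (P.card : ℝ) * unitCellVolume b' := by positivity
  have : (A.card : ℝ) ≤ N.card := by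
    refine le_of_mul_le_mul_left ?_ hpos
    calc (P.card : ℝ) * unitCellVolume b' * A.card
        = P'.card * (A.card * unitCellVolume b) := by rw [hden]; ring
      _ ≤ _ := hreal
      _ = _ := by ring
  exact_mod_cast this

/-- Hall's theorem for an infinite family needs finite neighbourhoods; these are finite because the
neighbours of `x` lie in a ball, which meets `Y` in finitely many points. -/
theorem IsRepresentation.exists_injective_cellsMeet (h : IsRepresentation X b P)
    (h' : IsRepresentation Y b' P')
    (hden : (P.card : ℝ) / unitCellVolume b = P'.card / unitCellVolume b') :
    ∃ f : X → Y, Function.Injective f ∧ ∀ x : X, CellsMeet b b' x (f x) := by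
  classical
  obtain ⟨C, hC⟩ := exists_norm_sub_le_of_cellsMeet b b'
  have hfin : ∀ x : X, {y ∈ Y | CellsMeet b b' x y}.Finite := by
    intro x
    refine (h'.finite_inter_closedBall (‖(x : EuclideanSpace ℝ (Fin d))‖ + C)).subset ?_
    rintro y ⟨hy, hxy⟩
    refine ⟨hy, mem_closedBall_zero_iff.2 ?_⟩
    have h1 := hC _ _ hxy
    rw [norm_sub_rev] at h1
    have h2 := norm_le_norm_add_norm_sub' y (x : EuclideanSpace ℝ (Fin d))
    linarith
  obtain ⟨f, hf, hft⟩ := (Finset.all_card_le_biUnion_card_iff_exists_injective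
    fun x => (hfin x).toFinset).1 fun A => by
      rw [← Finset.card_map (Function.Embedding.subtype _)]
      refine h.card_le_card_of_cellsMeet h' hden ?_ ?_
      · intro x hx
        obtain ⟨u, -, rfl⟩ := Finset.mem_map.1 (Finset.mem_coe.1 hx)
        exact u.2
      · intro x hx y hy hxy
        obtain ⟨u, hu, rfl⟩ := Finset.mem_map.1 hx
        exact Finset.mem_biUnion.2 ⟨u, hu, (hfin u).mem_toFinset.2 ⟨hy, hxy⟩⟩
  have hft' : ∀ x : X, f x ∈ Y ∧ CellsMeet b b' x (f x) := fun x => (hfin x).mem_toFinset.1 (hft x)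
  exact ⟨fun x => ⟨f x, (hft' x).1⟩, fun x y hxy => hf (congrArg Subtype.val hxy),
    fun x => (hft' x).2⟩

theorem PPS.dB_lt_top_of_den_eq (X Y : PPS d) (hden : X.den = Y.den) :
    dB X.points Y.points < ∞ := by
  obtain ⟨b, P, h⟩ := X.2
  obtain ⟨b', P', h'⟩ := Y.2
  rw [X.den_eq h, Y.den_eq h'] at hden
  obtain ⟨C, hC⟩ := exists_norm_sub_le_of_cellsMeet b b'
  obtain ⟨f, hf, hfr⟩ := IsRepresentation.exists_injective_cellsMeet h h' hden
  obtain ⟨g, hg, hgr⟩ := IsRepresentation.exists_injective_cellsMeet h' h hden.symm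
  -- A bare bijection would carry no displacement bound. The relational form pairs points only along
  -- `f` or the inverse of `g`, so `CellsMeet` survives.
  obtain ⟨k, hk, hkr⟩ := Function.Embedding.schroeder_bernstein_of_rel hf hg
    (fun x y => CellsMeet b b' x y) hfr fun y => (hgr y).symm
  refine (iInf_le _ (Equiv.ofBijective k hk)).trans_lt
    ((iSup_le fun x => ?_).trans_lt (ENNReal.ofReal_lt_top (r := C)))
  rw [edist_dist, dist_eq_norm]
  exact ENNReal.ofReal_le_ofReal (hC _ _ (hkr x))

end Matching

/-! ### The equivalence and the large-scale components -/

theorem mainTheorem7 (d : ℕ) :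
    (∀ X Y : PPS d, List.TFAE
      [dEB X.points Y.points < ∞, dB X.points Y.points < ∞, X.den = Y.den]) ∧
    (∀ X : PPS d,
      largeScaleComponent (fun Y Z : PPS d => dEB Y.points Z.points) X =
        largeScaleComponent (fun Y Z : PPS d => dB Y.points Z.points) X ∧
      largeScaleComponent (fun Y Z : PPS d => dB Y.points Z.points) X =
        PPSOfDensity d X.den) := by
  have key : ∀ X Y : PPS d, List.TFAE
      [dEB X.points Y.points < ∞, dB X.points Y.points < ∞, X.den = Y.den] := by
    intro X Y
    tfae_have 1 → 3 := X.den_eq_of_dEB_lt_top Y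
    tfae_have 3 → 2 := X.dB_lt_top_of_den_eq Y
    tfae_have 2 → 1 := (dEB_le_dB _ _).trans_lt
    tfae_finish
  refine ⟨key, fun X => ⟨Set.ext fun Y => (key X Y).out 0 1, Set.ext fun Y => ?_⟩⟩
  exact ((key X Y).out 1 2).trans eq_comm
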